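/- Let $(\Sigma,\sigma)$ be a finite-dimensional real symplectic vector space and let $L(\Sigma)$ be the set of its Lagrangian planes, that is, of the subspaces of dimension $\frac12\dim\Sigma$ on which $\sigma$ vanishes. For $\Lambda_1,\Pi,\Lambda_2\in L(\Sigma)$ let $q$ be the (well-defined) quadratic form $$q(\lambda)=\sigma(\lambda_1,\lambda_2),\qquad \lambda=\lambda_1+\lambda_2,\quad \lambda_i\in\Lambda_i,$$ on $\big((\Lambda_1+\Lambda_2)\cap\Pi\big)/(\Lambda_1\cap\Pi\cap\Lambda_2)$, and put $$\operatorname{ind}_\Pi(\Lambda_1,\Lambda_2)=\operatorname{ind}^+q+\tfrac12\dim\ker q,$$ where $\operatorname{ind}^+ q$ is the maximal dimension of a subspace on which $q$ is positive definite. Let $T>0$. For an arbitrary (not necessarily continuous) curve $\Lambda:[0,T]\to L(\Sigma)$ and a partition $D=\{0=t_0<t_1<\dots<t_N=T\}$ put $$\operatorname{ind}^D_\Pi\Lambda=\sum_{i=0}^{N-1}\operatorname{ind}_\Pi(\Lambda(t_i),\Lambda(t_{i+1})),\qquad \operatorname{ind}_\Pi\Lambda=\sup_D\operatorname{ind}^D_\Pi\Lambda\in[0,+\infty].$$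 The curve is called monotone increasing if $\operatorname{ind}_{\Pi_0}\Lambda<+\infty$ for some $\Pi_0\in L(\Sigma)$. If $\Lambda$ is monotone increasing and closed, i.e. $\Lambda(0)=\Lambda(T)$, then $$\operatorname{ind}_\Pi\Lambda=\operatorname{ind}_\Delta\Lambda\qquad\text{for all }\Pi,\Delta\in L(\Sigma)$$ (in particular, $\operatorname{ind}_\Pi\Lambda$ is finite for every $\Pi\in L(\Sigma)$). -/

import Mathlib

namespace Symp

variable {V : Type*} [AddCommGroup V] [Module ℝ V]

/-- A symplectic form: an alternating non-degenerate bilinear form. -/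
structure IsSymplectic (σ : LinearMap.BilinForm ℝ V) : Prop where
  alt : σ.IsAlt
  nondegenerate : σ.Nondegenerate

/-- Lagrangian planes: isotropic subspaces of half the dimension of the space. -/
@[ext]
structure LagrangianPlane (σ : LinearMap.BilinForm ℝ V) where
  carrier : Submodule ℝ V
  isotropic : ∀ x ∈ carrier, ∀ y ∈ carrier, σ x y = 0
  two_mul_finrank : 2 * Module.finrank ℝ carrier = Module.finrank ℝ V

variable {σ : LinearMap.BilinForm ℝ V}

/-- Every vector of `A + B` is `a + b` with `a ∈ A`, `b ∈ B`, and both can be chosen linearly. -/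
theorem exists_splitting (A B : Submodule ℝ V) :
    ∃ s : ↥(A ⊔ B) →ₗ[ℝ] V × V,
      ∀ x, (s x).1 ∈ A ∧ (s x).2 ∈ B ∧ (s x).1 + (s x).2 = (x : V) := by
  have hmem : ∀ p : A × B, (p.1 : V) + (p.2 : V) ∈ A ⊔ B := fun p =>
    Submodule.add_mem_sup p.1.2 p.2.2
  let f : (A × B) →ₗ[ℝ] ↥(A ⊔ B) :=
    LinearMap.codRestrict (A ⊔ B) (A.subtype.coprod B.subtype) hmem
  have hf : LinearMap.range f = ⊤ := by
    rw [LinearMap.range_eq_top]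
    rintro ⟨x, hx⟩
    obtain ⟨a, ha, b, hb, rfl⟩ := Submodule.mem_sup.1 hx
    exact ⟨(⟨a, ha⟩, ⟨b, hb⟩), rfl⟩
  obtain ⟨g, hg⟩ := f.exists_rightInverse_of_surjective hf
  refine ⟨(A.subtype.prodMap B.subtype) ∘ₗ g, fun x => ⟨(g x).1.2, (g x).2.2, ?_⟩⟩
  exact congrArg Subtype.val (LinearMap.congr_fun hg x)

/-- The space `(Λ₁ + Λ₂) ∩ Γ`. -/
def formSpace (Λ₁ Γ Λ₂ : LagrangianPlane σ) : Submodule ℝ V :=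
  (Λ₁.carrier ⊔ Λ₂.carrier) ⊓ Γ.carrier

/-- `Λ₁ ∩ Γ ∩ Λ₂`, as a subspace of `(Λ₁ + Λ₂) ∩ Γ`. -/
def tripleInter (Λ₁ Γ Λ₂ : LagrangianPlane σ) : Submodule ℝ (formSpace Λ₁ Γ Λ₂) :=
  (Λ₁.carrier ⊓ Γ.carrier ⊓ Λ₂.carrier).comap (formSpace Λ₁ Γ Λ₂).subtype

theorem formSpace_splitting (Λ₁ Γ Λ₂ : LagrangianPlane σ) :
    ∃ s : formSpace Λ₁ Γ Λ₂ →ₗ[ℝ] V × V,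
      ∀ x, (s x).1 ∈ Λ₁.carrier ∧ (s x).2 ∈ Λ₂.carrier ∧ (s x).1 + (s x).2 = (x : V) := by
  obtain ⟨s, hs⟩ := exists_splitting Λ₁.carrier Λ₂.carrier
  have hle : formSpace Λ₁ Γ Λ₂ ≤ Λ₁.carrier ⊔ Λ₂.carrier := inf_le_left
  exact ⟨s ∘ₗ Submodule.inclusion hle, fun x => hs (Submodule.inclusion hle x)⟩

/-- The quadratic form `q(x) = σ(x₁, x₂)`, `x = x₁ + x₂`, `xᵢ ∈ Λᵢ`, on `(Λ₁ + Λ₂) ∩ Γ`.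
It is computed from one choice of the decompositions; `preForm_eq` says that the value is the same
for every decomposition. -/
noncomputable def preForm (Λ₁ Γ Λ₂ : LagrangianPlane σ) :
    QuadraticForm ℝ (formSpace Λ₁ Γ Λ₂) :=
  LinearMap.BilinMap.toQuadraticMap
    (σ.compl₁₂ (LinearMap.fst ℝ V V ∘ₗ (formSpace_splitting Λ₁ Γ Λ₂).choose)
      (LinearMap.snd ℝ V V ∘ₗ (formSpace_splitting Λ₁ Γ Λ₂).choose))

theorem preForm_eq (Λ₁ Γ Λ₂ : LagrangianPlane σ) (x : formSpace Λ₁ Γ Λ₂) {a b : V}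
    (ha : a ∈ Λ₁.carrier) (hb : b ∈ Λ₂.carrier) (hab : a + b = (x : V)) :
    preForm Λ₁ Γ Λ₂ x = σ a b := by
  obtain ⟨h1, h2, h3⟩ := (formSpace_splitting Λ₁ Γ Λ₂).choose_spec x
  change σ ((formSpace_splitting Λ₁ Γ Λ₂).choose x).1
    ((formSpace_splitting Λ₁ Γ Λ₂).choose x).2 = σ a b
  set u := ((formSpace_splitting Λ₁ Γ Λ₂).choose x).1
  set v := ((formSpace_splitting Λ₁ Γ Λ₂).choose x).2
  have hx : u + v = a + b := h3.trans hab.symm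
  have hd : u - a = b - v := by
    rw [sub_eq_sub_iff_add_eq_add, hx, add_comm]
  have e1 : σ u (b - v) = 0 := by
    rw [← hd]; exact Λ₁.isotropic _ h1 _ (sub_mem h1 ha)
  have e2 : σ (u - a) b = 0 := by
    rw [hd]; exact Λ₂.isotropic _ (sub_mem hb h2) _ hb
  rw [map_sub, sub_eq_zero] at e1
  rw [map_sub, LinearMap.sub_apply, sub_eq_zero] at e2
  rw [← e1, e2]

theorem tripleInter_le_radical (Λ₁ Γ Λ₂ : LagrangianPlane σ) :
    tripleInter Λ₁ Γ Λ₂ ≤ (preForm Λ₁ Γ Λ₂).radical := by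
  intro x hx
  have hx1 : (x : V) ∈ Λ₁.carrier := hx.1.1
  have hx2 : (x : V) ∈ Λ₂.carrier := hx.2
  rw [QuadraticMap.mem_radical_iff']
  constructor
  · rw [preForm_eq Λ₁ Γ Λ₂ x hx1 (zero_mem _) (add_zero _), map_zero]
  · intro y
    obtain ⟨a, ha, b, hb, hab⟩ := Submodule.mem_sup.1 y.2.1
    rw [preForm_eq Λ₁ Γ Λ₂ y ha hb hab,
      preForm_eq Λ₁ Γ Λ₂ (x + y) (add_mem hx1 ha) hb
        (by rw [add_assoc, hab]; rfl),
      map_add, LinearMap.add_apply]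
    have : σ (x : V) b = 0 := Λ₂.isotropic _ hx2 _ hb
    rw [this, zero_add]

/-- The quadratic form `q(x) = σ(x₁, x₂)` on `((Λ₁ + Λ₂) ∩ Γ) / (Λ₁ ∩ Γ ∩ Λ₂)`. -/
noncomputable def form (Λ₁ Γ Λ₂ : LagrangianPlane σ) :
    QuadraticForm ℝ (formSpace Λ₁ Γ Λ₂ ⧸ tripleInter Λ₁ Γ Λ₂) :=
  (preForm Λ₁ Γ Λ₂).lift (tripleInter Λ₁ Γ Λ₂) (tripleInter_le_radical Λ₁ Γ Λ₂)

/-- The positive Maslov index `ind_Γ(Λ₁, Λ₂) = ind⁺ q + (1/2) dim ker q`. -/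
noncomputable def posMaslovIndex (Γ Λ₁ Λ₂ : LagrangianPlane σ) : ℝ :=
  (sigPos (form Λ₁ Γ Λ₂) : ℝ) + (1 / 2 : ℝ) * (Module.finrank ℝ (form Λ₁ Γ Λ₂).radical : ℝ)

/-- A partition `0 = t₀ < t₁ < ⋯ < t_N = T` of `[0, T]`. -/
structure IntervalPartition (T : ℝ) where
  N : ℕ
  t : Fin (N + 1) → Set.Icc (0 : ℝ) T
  strictMono : StrictMono t
  first : (t 0 : ℝ) = 0
  last : (t (Fin.last N) : ℝ) = T

/-- `ind_Γ^D Λ = ∑_{i=0}^{N-1} ind_Γ(Λ(t_i), Λ(t_{i+1}))`. -/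
noncomputable def partitionIndex {T : ℝ} (Γ : LagrangianPlane σ)
    (Λ : Set.Icc (0 : ℝ) T → LagrangianPlane σ) (D : IntervalPartition T) : ℝ :=
  ∑ i : Fin D.N, posMaslovIndex Γ (Λ (D.t i.castSucc)) (Λ (D.t i.succ))

/-- `ind_Γ Λ = sup_D ind_Γ^D Λ`, a supremum in the extended reals. -/
noncomputable def curveIndex {T : ℝ} (Γ : LagrangianPlane σ)
    (Λ : Set.Icc (0 : ℝ) T → LagrangianPlane σ) : EReal :=
  ⨆ D : IntervalPartition T, ((partitionIndex Γ Λ D : ℝ) : EReal)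

/-- `Λ` is monotone increasing if `ind_Γ Λ < +∞` for some Lagrangian plane `Γ`. No continuity of
`Λ` is required. -/
def IsMonotoneIncreasing {T : ℝ} (Λ : Set.Icc (0 : ℝ) T → LagrangianPlane σ) : Prop :=
  ∃ Γ : LagrangianPlane σ, curveIndex Γ Λ < ⊤

end Symp

/-! Let τ(a, b, c) be the signature of σ(x, y) on pairs x ∈ a, y ∈ b with x + y ∈ c (`tripleIndex`).
Since ind⁺ + ½ dim ker is half of signature plus dimension, `posMaslovIndex_eq` gives ind_c(a, b) =
½ τ(a, b, c) plus a term that depends only on a and b. The cocycle identity for τ then turns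
ind_Γ(a, b) − ind_Δ(a, b) into g(b) − g(a) with g(x) = ½ τ(x, Γ, Δ). Summed over a partition this
telescopes, and vanishes on a closed curve. So the two indices agree partition by partition, hence
so do the suprema; finiteness for one plane passes to all.

The cocycle identity (`tripleIndex_cocycle`) holds because both sides are the signature of the area
form on quadrilaterals. Each diagonal yields an area-preserving map from pairs of triangles onto the
orthogonal complement of an isotropic subspace, and passing to such a complement keeps the signature
(`signature_restrict_orthogonal`). -/

open QuadraticMap Module

/-! ### Signatures of possibly degenerate real quadratic forms -/

section Signature

variable {M M' : Type*} [AddCommGroup M] [Module ℝ M] [FiniteDimensional ℝ M]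
  [AddCommGroup M'] [Module ℝ M'] [FiniteDimensional ℝ M']

namespace QuadraticForm

/-- The signature of a real quadratic form: the number of positive squares minus the number of
negative squares. -/
noncomputable def signature (Q : QuadraticForm ℝ M) : ℤ :=
  (sigPos Q : ℤ) - sigNeg Q

/-- A positive definite space mapped isometrically into `M'` bounds the positive index below. -/
theorem finrank_le_sigPos_of_map {U : Type*} [AddCommGroup U] [Module ℝ U]
    {Q : QuadraticForm ℝ U} (hQ : Q.PosDef)
    {Q' : QuadraticForm ℝ M'} (f : U →ₗ[ℝ] M') (hf : ∀ x, Q' (f x) = Q x) :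
    finrank ℝ U ≤ sigPos Q' := by
  have hinj : Function.Injective f := by
    rw [← LinearMap.ker_eq_bot, LinearMap.ker_eq_bot']
    intro x h
    by_contra h0
    have h1 := hQ x h0
    rw [← hf, h, map_zero] at h1
    exact h1.false
  have hdef : (Q'.restrict (LinearMap.range f)).PosDef := by
    rintro ⟨_, ⟨x, rfl⟩⟩ h0
    have hx0 : x ≠ 0 := by
      rintro rfl
      exact h0 (Subtype.ext (by simp))
    have := hQ x hx0
    rw [← hf] at this
    simpa using this
  rw [← LinearMap.finrank_range_of_inj hinj]
  exact le_sigPos_of_posDef Q' hdef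

/-- A form-preserving linear map does not decrease the positive index. -/
theorem sigPos_le_of_map {Q : QuadraticForm ℝ M} {Q' : QuadraticForm ℝ M'} (f : M →ₗ[ℝ] M')
    (hf : ∀ x, Q' (f x) = Q x) : sigPos Q ≤ sigPos Q' := by
  obtain ⟨U, hU, hpos⟩ := exists_finrank_eq_sigPos_and_posDef Q
  rw [← hU]
  exact finrank_le_sigPos_of_map hpos (f.domRestrict U) fun x => by simp [hf]

theorem sigPos_eq_of_surjective {Q : QuadraticForm ℝ M} {Q' : QuadraticForm ℝ M'}
    (f : M →ₗ[ℝ] M') (hf : ∀ x, Q' (f x) = Q x) (hs : Function.Surjective f) :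
    sigPos Q = sigPos Q' := by
  obtain ⟨g, hg⟩ := f.exists_rightInverse_of_surjective (LinearMap.range_eq_top.2 hs)
  refine le_antisymm (sigPos_le_of_map f hf) (sigPos_le_of_map g fun x => ?_)
  rw [← hf, ← LinearMap.comp_apply, hg, LinearMap.id_apply]

/-- The signature is unchanged by pulling back along a surjection. -/
theorem signature_eq_of_surjective {Q : QuadraticForm ℝ M} {Q' : QuadraticForm ℝ M'}
    (f : M →ₗ[ℝ] M') (hf : ∀ x, Q' (f x) = Q x) (hs : Function.Surjective f) :
    signature Q = signature Q' := by
  have h : sigNeg Q = sigNeg Q' := by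
    rw [← sigPos_neg, ← sigPos_neg]
    exact sigPos_eq_of_surjective f (fun x => by simp [hf]) hs
  rw [signature, signature, h, sigPos_eq_of_surjective f hf hs]

theorem sigPos_add_le_prod (Q : QuadraticForm ℝ M) (Q' : QuadraticForm ℝ M') :
    sigPos Q + sigPos Q' ≤ sigPos (Q.prod Q') := by
  obtain ⟨U, hU, hpos⟩ := exists_finrank_eq_sigPos_and_posDef Q
  obtain ⟨U', hU', hpos'⟩ := exists_finrank_eq_sigPos_and_posDef Q'
  rw [← hU, ← hU', ← finrank_prod]
  exact finrank_le_sigPos_of_map (hpos.prod hpos') (U.subtype.prodMap U'.subtype)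
    fun x => by simp

theorem finrank_radical_add_le_prod (Q : QuadraticForm ℝ M) (Q' : QuadraticForm ℝ M') :
    finrank ℝ Q.radical + finrank ℝ Q'.radical ≤ finrank ℝ (Q.prod Q').radical := by
  rw [← finrank_prod]
  refine LinearMap.finrank_le_finrank_of_injective
    (f := (Q.radical.subtype.prodMap Q'.radical.subtype).codRestrict (Q.prod Q').radical
      fun x => ?_) fun x y h => ?_
  · have h1 := mem_radical_iff'.1 x.1.2
    have h2 := mem_radical_iff'.1 x.2.2
    refine mem_radical_iff'.2 ⟨by simp [h1.1, h2.1], fun n => by simp [h1.2, h2.2]⟩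
  · have h' := congrArg Subtype.val h
    simp only [LinearMap.codRestrict_apply, LinearMap.prodMap_apply, Submodule.subtype_apply,
      Prod.mk.injEq, SetLike.coe_eq_coe] at h'
    exact Prod.ext h'.1 h'.2

/-- The signature is additive under orthogonal sums. -/
theorem signature_prod (Q : QuadraticForm ℝ M) (Q' : QuadraticForm ℝ M') :
    signature (Q.prod Q') = signature Q + signature Q' := by
  have h1 := sigPos_add_le_prod Q Q'
  have h2 := sigPos_add_le_prod (-Q) (-Q')
  have h3 : (-Q).prod (-Q') = -(Q.prod Q') := by
    ext x
    simp [add_comm]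
  rw [h3] at h2
  simp only [sigPos_neg] at h2
  have h4 := finrank_radical_add_le_prod Q Q'
  have e1 := sigPos_add_sigNeg_add_radical (Q := Q)
  have e2 := sigPos_add_sigNeg_add_radical (Q := Q')
  have e3 := sigPos_add_sigNeg_add_radical (Q := Q.prod Q')
  rw [finrank_prod] at e3
  simp only [signature]
  -- Positive index, negative index and nullity are each superadditive, while their sum is the
  -- dimension, which is additive; so all three are additive.
  lia

/-- The positive index drops by at most the codimension on passing to a subspace. -/
theorem sigPos_add_finrank_le_restrict (Q : QuadraticForm ℝ M) (N : Submodule ℝ M) :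
    sigPos Q + finrank ℝ N ≤ sigPos (Q.restrict N) + finrank ℝ M := by
  obtain ⟨U, hU, hpos⟩ := exists_finrank_eq_sigPos_and_posDef Q
  have h1 : finrank ℝ ↥(U ⊓ N) ≤ sigPos (Q.restrict N) := by
    refine finrank_le_sigPos_of_map (Q := Q.restrict (U ⊓ N)) (fun x hx => ?_)
      (Submodule.inclusion inf_le_right) fun x => by simp
    have := hpos ⟨x, x.2.1⟩ (by simpa using hx)
    simpa using this
  have h2 := Submodule.finrank_sup_add_finrank_inf_eq U N
  have h3 := (U ⊔ N).finrank_le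
  lia

/-- Isotropic reduction: the restriction of a quadratic form to the orthogonal complement of an
isotropic subspace has the same signature. -/
theorem signature_restrict_orthogonal (Q : QuadraticForm ℝ M) (W : Submodule ℝ M)
    (hW : ∀ w ∈ W, Q w = 0) :
    signature (Q.restrict (LinearMap.BilinForm.orthogonal Q.polarBilin W)) = signature Q := by
  set N := LinearMap.BilinForm.orthogonal Q.polarBilin W with hN
  have hmem : ∀ x, x ∈ N ↔ ∀ w ∈ W, polar Q w x = 0 := fun x => Iff.rfl
  have h1 := sigPos_add_finrank_le_restrict Q N
  have h2 := sigPos_add_finrank_le_restrict (-Q) N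
  have h3 : (-Q).restrict N = -(Q.restrict N) := by
    ext x
    simp
  rw [h3] at h2
  simp only [sigPos_neg] at h2
  have e1 := sigPos_add_sigNeg_add_radical (Q := Q)
  have e2 := sigPos_add_sigNeg_add_radical (Q := Q.restrict N)
  have h4 := LinearMap.BilinForm.finrank_add_finrank_orthogonal' (B := Q.polarBilin) W
  rw [← radical_eq_ker_polarBilin, ← hN] at h4
  have h5 := Submodule.finrank_sup_add_finrank_inf_eq W Q.radical
  have hle : W ⊔ Q.radical ≤ N := by
    refine sup_le (fun x hx => (hmem x).2 fun w hw => ?_) fun x hx => (hmem x).2 fun w _ => ?_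
    · simp [polar, hW _ hx, hW _ hw, hW _ (add_mem hw hx)]
    · have := mem_radical_iff'.1 hx
      rw [polar_comm]
      simp [polar, this.1, this.2]
  have h6 : finrank ℝ ↥(W ⊔ Q.radical) ≤ finrank ℝ (Q.restrict N).radical := by
    rw [← (Submodule.comapSubtypeEquivOfLe hle).finrank_eq]
    refine Submodule.finrank_mono fun x hx => ?_
    obtain ⟨w, hw, r, hr, hx⟩ := Submodule.mem_sup.1 (show (x : M) ∈ W ⊔ Q.radical from hx)
    have key : ∀ n : N, Q (x + n) = Q n := fun n => by
      rw [← hx, add_right_comm, add_comm, (mem_radical_iff'.1 hr).2]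
      have h := (hmem n).1 n.2 w hw
      rw [polar, hW w hw] at h
      linarith
    refine mem_radical_iff'.2 ⟨?_, fun n => by simpa using key n⟩
    simpa using key 0
  -- Both indices drop by at most codim N. As the radical on N contains W + rad Q, counting
  -- dimensions forces equality in both bounds, so the difference is unchanged.
  simp only [signature]
  lia

/-- An isometric map onto the orthogonal complement of an isotropic subspace preserves the
signature. -/
theorem signature_eq_of_range_eq_orthogonal {Q : QuadraticForm ℝ M} {Q' : QuadraticForm ℝ M'}
    (f : M →ₗ[ℝ] M') (hf : ∀ x, Q' (f x) = Q x) (W : Submodule ℝ M')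
    (hW : ∀ w ∈ W, Q' w = 0) (horth : ∀ x, ∀ w ∈ W, polar Q' w (f x) = 0)
    (hrange : ∀ z, (∀ w ∈ W, polar Q' w z = 0) → ∃ x, f x = z) :
    signature Q = signature Q' := by
  rw [← signature_restrict_orthogonal Q' W hW]
  refine signature_eq_of_surjective
    (f.codRestrict (LinearMap.BilinForm.orthogonal Q'.polarBilin W) fun x w hw => horth x w hw)
    (fun x => hf x) fun z => ?_
  obtain ⟨x, hx⟩ := hrange z fun w hw => z.2 w hw
  exact ⟨x, Subtype.ext hx⟩

end QuadraticForm

end Signature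

/-! ### Triangles, quadrilaterals and Lagrangian orthogonality -/

namespace Symp

open QuadraticForm

variable {V : Type*} [AddCommGroup V] [Module ℝ V] {σ : LinearMap.BilinForm ℝ V}

/-- Triangles with sides in `a`, `b`, `c`, given by their first two sides. -/
def triangles (a b c : LagrangianPlane σ) : Submodule ℝ (V × V) :=
  (a.carrier.prod b.carrier) ⊓
    c.carrier.comap (LinearMap.fst ℝ V V + LinearMap.snd ℝ V V)

theorem mem_triangles {a b c : LagrangianPlane σ} {x : V × V} :
    x ∈ triangles a b c ↔ (x.1 ∈ a.carrier ∧ x.2 ∈ b.carrier) ∧ x.1 + x.2 ∈ c.carrier :=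
  Iff.rfl

/-- Quadrilaterals with sides in `a`, `b`, `c`, `d`, given by their first three sides. -/
def quadrilaterals (a b c d : LagrangianPlane σ) : Submodule ℝ (V × V × V) :=
  (a.carrier.prod (b.carrier.prod c.carrier)) ⊓
    d.carrier.comap (LinearMap.id.coprod (LinearMap.id.coprod LinearMap.id))

theorem mem_quadrilaterals {a b c d : LagrangianPlane σ} {x : V × V × V} :
    x ∈ quadrilaterals a b c d ↔
      (x.1 ∈ a.carrier ∧ x.2.1 ∈ b.carrier ∧ x.2.2 ∈ c.carrier) ∧
        x.1 + (x.2.1 + x.2.2) ∈ d.carrier :=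
  Iff.rfl

/-- The symplectic area of a triangle. -/
noncomputable def triangleArea (a b c : LagrangianPlane σ) :
    QuadraticForm ℝ (triangles a b c) :=
  (LinearMap.BilinMap.toQuadraticMap
    (σ.compl₁₂ (LinearMap.fst ℝ V V) (LinearMap.snd ℝ V V))).restrict _

theorem triangleArea_apply (a b c : LagrangianPlane σ) (x : triangles a b c) :
    triangleArea a b c x = σ x.1.1 x.1.2 :=
  rfl

/-- The symplectic area of a quadrilateral. -/
noncomputable def quadrilateralArea (a b c d : LagrangianPlane σ) :
    QuadraticForm ℝ (quadrilaterals a b c d) :=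
  (LinearMap.BilinMap.toQuadraticMap
    (σ.compl₁₂ (LinearMap.fst ℝ V (V × V)) (LinearMap.fst ℝ V V ∘ₗ LinearMap.snd ℝ V (V × V)) +
      σ.compl₁₂ (LinearMap.fst ℝ V (V × V) + LinearMap.fst ℝ V V ∘ₗ LinearMap.snd ℝ V (V × V))
        (LinearMap.snd ℝ V V ∘ₗ LinearMap.snd ℝ V (V × V)))).restrict _

theorem quadrilateralArea_apply (a b c d : LagrangianPlane σ) (x : quadrilaterals a b c d) :
    quadrilateralArea a b c d x = σ x.1.1 x.1.2.1 + σ (x.1.1 + x.1.2.1) x.1.2.2 :=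
  rfl

variable [FiniteDimensional ℝ V]

/-- The Maslov (Kashiwara) index of a triple of Lagrangian planes. -/
noncomputable def tripleIndex (a b c : LagrangianPlane σ) : ℤ :=
  signature (triangleArea a b c)

theorem orthogonal_carrier (hσ : IsSymplectic σ) (a : LagrangianPlane σ) :
    σ.orthogonal a.carrier = a.carrier := by
  have hle : a.carrier ≤ σ.orthogonal a.carrier := fun x hx y hy => a.isotropic y hy x hx
  refine (Submodule.eq_of_le_of_finrank_le hle ?_).symm
  rw [LinearMap.BilinForm.finrank_orthogonal hσ.nondegenerate]
  have := a.two_mul_finrank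
  lia

theorem mem_of_forall (hσ : IsSymplectic σ) {a : LagrangianPlane σ} {x : V}
    (h : ∀ y ∈ a.carrier, σ y x = 0) : x ∈ a.carrier := by
  rw [← orthogonal_carrier hσ a]
  exact h

/-- Dual to (a + b)^⊥ = a ∩ b, which follows from a^⊥ = a and b^⊥ = b; take orthogonals once more.
-/
theorem orthogonal_inf (hσ : IsSymplectic σ) (a b : LagrangianPlane σ) :
    σ.orthogonal (a.carrier ⊓ b.carrier) = a.carrier ⊔ b.carrier := by
  have h : σ.orthogonal (a.carrier ⊔ b.carrier) = a.carrier ⊓ b.carrier := by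
    ext x
    constructor
    · intro hx
      exact ⟨mem_of_forall hσ fun y hy => hx y (Submodule.mem_sup_left hy),
        mem_of_forall hσ fun y hy => hx y (Submodule.mem_sup_right hy)⟩
    · intro hx y hy
      obtain ⟨u, hu, v, hv, rfl⟩ := Submodule.mem_sup.1 hy
      change σ (u + v) x = 0
      rw [map_add, LinearMap.add_apply, a.isotropic u hu x hx.1, b.isotropic v hv x hx.2,
        add_zero]
  rw [← h, LinearMap.BilinForm.orthogonal_orthogonal hσ.nondegenerate hσ.alt.isRefl]

theorem exists_add_of_forall (hσ : IsSymplectic σ) {a b : LagrangianPlane σ} {x : V}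
    (h : ∀ w ∈ a.carrier, w ∈ b.carrier → σ w x = 0) :
    ∃ u ∈ a.carrier, ∃ v ∈ b.carrier, u + v = x := by
  rw [← Submodule.mem_sup, ← orthogonal_inf hσ]
  exact fun w hw => h w hw.1 hw.2

/-! ### The cocycle identity from the two cuts of a quadrilateral -/

/-- Cutting a quadrilateral along the diagonal between its sides `b` and `c`. -/
theorem tripleIndex_add_eq_quadrilateral (hσ : IsSymplectic σ) (a b c d : LagrangianPlane σ) :
    tripleIndex a b c + tripleIndex a c d = signature (quadrilateralArea a b c d) := by
  have hneg : ∀ x y, σ x y = -σ y x := fun x y => (LinearMap.IsAlt.neg hσ.alt y x).symm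
  rw [tripleIndex, tripleIndex, ← signature_prod]
  let f : (triangles a b c × triangles a c d) →ₗ[ℝ] quadrilaterals a b c d :=
    { toFun := fun p => ⟨(p.1.1.1 + p.2.1.1, p.1.1.2, p.2.1.2 - (p.1.1.1 + p.1.1.2)), by
        obtain ⟨⟨⟨x, y⟩, h⟩, ⟨⟨z, t⟩, h'⟩⟩ := p
        rw [mem_triangles] at h h'
        refine mem_quadrilaterals.2
          ⟨⟨add_mem h.1.1 h'.1.1, h.1.2, sub_mem h'.1.2 h.2⟩, ?_⟩
        convert h'.2 using 1
        simp only
        abel⟩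
      map_add' := fun p q => by
        ext <;> simp <;> abel
      map_smul' := fun r p => by
        ext <;> simp [smul_sub] }
  -- The degenerate quadrilaterals (w, 0, -w) with w ∈ a ∩ c.
  let W : Submodule ℝ (quadrilaterals a b c d) :=
    LinearMap.ker ((LinearMap.fst ℝ V V ∘ₗ LinearMap.snd ℝ V (V × V)) ∘ₗ
      (quadrilaterals a b c d).subtype) ⊓
    LinearMap.ker ((LinearMap.fst ℝ V (V × V) +
      LinearMap.snd ℝ V V ∘ₗ LinearMap.snd ℝ V (V × V)) ∘ₗ (quadrilaterals a b c d).subtype)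
  have hWmem : ∀ w, w ∈ W ↔ w.1.2.1 = 0 ∧ w.1.1 + w.1.2.2 = 0 := fun w => Iff.rfl
  have hpolar : ∀ w ∈ W, ∀ z, polar (quadrilateralArea a b c d) w z = 2 * σ w.1.1 z.1.2.1 := by
    intro w hw z
    obtain ⟨h2, h3⟩ := (hWmem w).1 hw
    have h3' := eq_neg_of_add_eq_zero_right h3
    obtain ⟨⟨hw1, -, hw3⟩, -⟩ := mem_quadrilaterals.1 w.2
    obtain ⟨⟨hz1, -, hz3⟩, -⟩ := mem_quadrilaterals.1 z.2
    have i1 := a.isotropic _ hw1 _ hw1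
    have i2 := a.isotropic _ hz1 _ hw1
    have i3 := c.isotropic _ hw3 _ hz3
    have i4 := hneg z.1.2.1 w.1.1
    simp only [h3', map_neg, LinearMap.neg_apply, neg_eq_zero] at i3
    simp only [polar, quadrilateralArea_apply, Submodule.coe_add, Prod.fst_add, Prod.snd_add,
      map_add, LinearMap.add_apply, h2, h3', map_neg, map_zero, LinearMap.zero_apply]
    linarith
  refine signature_eq_of_range_eq_orthogonal f ?_ W ?_ ?_ ?_
  · rintro ⟨x, y⟩
    obtain ⟨⟨hx1, hx2⟩, hx3⟩ := mem_triangles.1 x.2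
    obtain ⟨⟨hy1, hy2⟩, hy3⟩ := mem_triangles.1 y.2
    have i1 := a.isotropic _ hx1 _ hx1
    have i2 := a.isotropic _ hy1 _ hx1
    have i3 := c.isotropic _ hx3 _ hx3
    have i4 := c.isotropic _ hx3 _ hy2
    simp only [map_add, LinearMap.add_apply] at i3 i4
    simp only [f, LinearMap.coe_mk, AddHom.coe_mk, quadrilateralArea_apply, QuadraticMap.prod_apply,
      triangleArea_apply, map_add, map_sub, LinearMap.add_apply]
    linarith
  · intro w hw
    obtain ⟨h2, h3⟩ := (hWmem w).1 hw
    have i1 := a.isotropic _ (mem_quadrilaterals.1 w.2).1.1 _ (mem_quadrilaterals.1 w.2).1.1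
    simp [quadrilateralArea_apply, h2, eq_neg_of_add_eq_zero_right h3, i1]
  · rintro ⟨x, y⟩ w hw
    rw [hpolar w hw]
    obtain ⟨⟨hx1, -⟩, hx3⟩ := mem_triangles.1 x.2
    obtain ⟨⟨hw1, -, hw3⟩, -⟩ := mem_quadrilaterals.1 w.2
    have h3' := eq_neg_of_add_eq_zero_right ((hWmem w).1 hw).2
    have i1 := a.isotropic _ hw1 _ hx1
    have i2 := c.isotropic _ hw3 _ hx3
    simp only [h3', map_neg, LinearMap.neg_apply, map_add] at i2
    simp only [f, LinearMap.coe_mk, AddHom.coe_mk]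
    linarith
  · intro z hz
    obtain ⟨⟨hz1, hz2, hz3⟩, hz4⟩ := mem_quadrilaterals.1 z.2
    -- Orthogonality to W says that the second side lies in (a ∩ c)^⊥ = a + c; this splitting
    -- supplies the diagonal v ∈ c.
    obtain ⟨u, hu, v, hv, huv⟩ := exists_add_of_forall hσ (a := a) (b := c) (x := z.1.2.1) (by
      intro w ha hc
      have hw : (w, 0, -w) ∈ quadrilaterals a b c d :=
        mem_quadrilaterals.2 ⟨⟨ha, zero_mem _, neg_mem hc⟩, by simp⟩
      have hwW : (⟨_, hw⟩ : quadrilaterals a b c d) ∈ W := (hWmem _).2 (by simp)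
      have := hz _ hwW
      rw [hpolar _ hwW] at this
      simpa using this)
    refine ⟨⟨⟨(-u, z.1.2.1), mem_triangles.2 ⟨⟨neg_mem hu, hz2⟩, ?_⟩⟩,
      ⟨(z.1.1 + u, z.1.2.2 + v), mem_triangles.2 ⟨⟨add_mem hz1 hu, add_mem hz3 hv⟩, ?_⟩⟩⟩, ?_⟩
    · simpa [← huv] using hv
    · convert hz4 using 1
      rw [← huv]
      simp only
      abel
    · refine Subtype.ext (Prod.ext ?_ (Prod.ext ?_ ?_))
      · simp [f]
      · simp [f]
      · simp [f, ← huv]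

/-- Cutting a quadrilateral along the other diagonal. -/
theorem tripleIndex_add_eq_quadrilateral' (hσ : IsSymplectic σ) (a b c d : LagrangianPlane σ) :
    tripleIndex b c d + tripleIndex a b d = signature (quadrilateralArea a b c d) := by
  have hneg : ∀ x y, σ x y = -σ y x := fun x y => (LinearMap.IsAlt.neg hσ.alt y x).symm
  rw [tripleIndex, tripleIndex, ← signature_prod]
  let f : (triangles b c d × triangles a b d) →ₗ[ℝ] quadrilaterals a b c d :=
    { toFun := fun p => ⟨(p.2.1.1, p.1.1.1 + p.2.1.2, p.1.1.2), by
        obtain ⟨⟨⟨x, y⟩, h⟩, ⟨⟨z, t⟩, h'⟩⟩ := p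
        rw [mem_triangles] at h h'
        refine mem_quadrilaterals.2 ⟨⟨h'.1.1, add_mem h.1.1 h'.1.2, h.1.2⟩, ?_⟩
        convert add_mem h.2 h'.2 using 1
        simp only
        abel⟩
      map_add' := fun p q => by
        ext <;> simp <;> abel
      map_smul' := fun r p => by
        ext <;> simp }
  -- Here the degenerate quadrilaterals are (0, w, 0) with w ∈ b ∩ d, and orthogonality to them puts
  -- the third side in b + d.
  let W : Submodule ℝ (quadrilaterals a b c d) :=
    LinearMap.ker (LinearMap.fst ℝ V (V × V) ∘ₗ (quadrilaterals a b c d).subtype) ⊓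
    LinearMap.ker ((LinearMap.snd ℝ V V ∘ₗ LinearMap.snd ℝ V (V × V)) ∘ₗ
      (quadrilaterals a b c d).subtype)
  have hWmem : ∀ w, w ∈ W ↔ w.1.1 = 0 ∧ w.1.2.2 = 0 := fun w => Iff.rfl
  have hpolar : ∀ w ∈ W, ∀ z, polar (quadrilateralArea a b c d) w z = 2 * σ w.1.2.1 z.1.2.2 := by
    intro w hw z
    obtain ⟨h1, h3⟩ := (hWmem w).1 hw
    obtain ⟨⟨-, hw2, -⟩, hw4⟩ := mem_quadrilaterals.1 w.2
    obtain ⟨⟨-, hz2, -⟩, hz4⟩ := mem_quadrilaterals.1 z.2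
    have i1 := b.isotropic _ hw2 _ hz2
    have i2 := d.isotropic _ hw4 _ hz4
    have i4 := hneg z.1.1 w.1.2.1
    simp only [h1, h3, zero_add, add_zero, map_add] at i2
    simp only [polar, quadrilateralArea_apply, Submodule.coe_add, Prod.fst_add, Prod.snd_add,
      map_add, LinearMap.add_apply, h1, h3, map_zero, LinearMap.zero_apply]
    linarith
  refine signature_eq_of_range_eq_orthogonal f ?_ W ?_ ?_ ?_
  · rintro ⟨x, y⟩
    obtain ⟨⟨hx1, -⟩, hx3⟩ := mem_triangles.1 x.2
    obtain ⟨⟨-, hy2⟩, hy3⟩ := mem_triangles.1 y.2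
    have i1 := b.isotropic _ hx1 _ hy2
    have i2 := d.isotropic _ hy3 _ hx3
    have i3 := hneg y.1.2 x.1.1
    simp only [map_add, LinearMap.add_apply] at i2
    simp only [f, LinearMap.coe_mk, AddHom.coe_mk, quadrilateralArea_apply, QuadraticMap.prod_apply,
      triangleArea_apply, map_add, LinearMap.add_apply]
    linarith
  · intro w hw
    obtain ⟨h1, h3⟩ := (hWmem w).1 hw
    simp [quadrilateralArea_apply, h1, h3]
  · rintro ⟨x, y⟩ w hw
    rw [hpolar w hw]
    obtain ⟨⟨hx1, -⟩, hx3⟩ := mem_triangles.1 x.2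
    obtain ⟨⟨-, hw2, -⟩, hw4⟩ := mem_quadrilaterals.1 w.2
    obtain ⟨h1, h3⟩ := (hWmem w).1 hw
    have i1 := b.isotropic _ hw2 _ hx1
    have i2 := d.isotropic _ hw4 _ hx3
    simp only [h1, h3, zero_add, add_zero, map_add] at i2
    simp only [f, LinearMap.coe_mk, AddHom.coe_mk]
    linarith
  · intro z hz
    obtain ⟨⟨hz1, hz2, hz3⟩, hz4⟩ := mem_quadrilaterals.1 z.2
    obtain ⟨u, hu, v, hv, huv⟩ := exists_add_of_forall hσ (a := b) (b := d) (x := z.1.2.2) (by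
      intro w hb hd
      have hw : (0, w, 0) ∈ quadrilaterals a b c d :=
        mem_quadrilaterals.2 ⟨⟨zero_mem _, hb, zero_mem _⟩, by simpa using hd⟩
      have hwW : (⟨_, hw⟩ : quadrilaterals a b c d) ∈ W := (hWmem _).2 (by simp)
      have := hz _ hwW
      rw [hpolar _ hwW] at this
      simpa using this)
    refine ⟨⟨⟨(-u, z.1.2.2), mem_triangles.2 ⟨⟨neg_mem hu, hz3⟩, ?_⟩⟩,
      ⟨(z.1.1, z.1.2.1 + u), mem_triangles.2 ⟨⟨hz1, add_mem hz2 hu⟩, ?_⟩⟩⟩, ?_⟩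
    · simpa [← huv] using hv
    · convert sub_mem hz4 hv using 1
      rw [← huv]
      simp only
      abel
    · refine Subtype.ext (Prod.ext ?_ (Prod.ext ?_ ?_)) <;> simp [f]

/-- The cocycle property of the triple index. -/
theorem tripleIndex_cocycle (hσ : IsSymplectic σ) (a b c d : LagrangianPlane σ) :
    tripleIndex a b c + tripleIndex a c d = tripleIndex b c d + tripleIndex a b d :=
  (tripleIndex_add_eq_quadrilateral hσ a b c d).trans
    (tripleIndex_add_eq_quadrilateral' hσ a b c d).symm

/-! ### From the triple index to the Maslov index -/

/-- The map (u, v) ↦ [u + v] carries triangles onto the quotient and pulls q back to the area form.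
-/
theorem signature_form (a b c : LagrangianPlane σ) :
    signature (form a c b) = tripleIndex a b c := by
  let f : triangles a b c →ₗ[ℝ] formSpace a c b :=
    ((LinearMap.fst ℝ V V + LinearMap.snd ℝ V V) ∘ₗ (triangles a b c).subtype).codRestrict _
      fun x => ⟨Submodule.add_mem_sup x.2.1.1 x.2.1.2, x.2.2⟩
  refine (signature_eq_of_surjective ((tripleInter a c b).mkQ ∘ₗ f) (fun x => ?_) ?_).symm
  · exact preForm_eq a c b (f x) x.2.1.1 x.2.1.2 rfl
  · refine (Submodule.mkQ_surjective _).comp fun y => ?_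
    obtain ⟨u, hu, v, hv, huv⟩ := Submodule.mem_sup.1 y.2.1
    exact ⟨⟨(u, v), ⟨hu, hv⟩, show u + v ∈ c.carrier from huv ▸ y.2.2⟩, Subtype.ext huv⟩

/-- The dimension of the space on which the form `q` lives does not depend on the middle plane. -/
theorem finrank_form_space (hσ : IsSymplectic σ) (a b c : LagrangianPlane σ) :
    2 * (finrank ℝ (formSpace a c b ⧸ tripleInter a c b) +
      finrank ℝ ↥(a.carrier ⊓ b.carrier)) = finrank ℝ V := by
  have h1 := Submodule.finrank_quotient_add_finrank (tripleInter a c b)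
  have hle : a.carrier ⊓ c.carrier ⊓ b.carrier ≤ formSpace a c b :=
    fun x hx => ⟨Submodule.mem_sup_left hx.1.1, hx.1.2⟩
  have h2 : finrank ℝ (tripleInter a c b) = finrank ℝ ↥(a.carrier ⊓ b.carrier ⊓ c.carrier) := by
    rw [inf_right_comm]
    exact (Submodule.comapSubtypeEquivOfLe hle).finrank_eq
  have h3 := Submodule.finrank_sup_add_finrank_inf_eq (a.carrier ⊓ b.carrier) c.carrier
  -- This makes the dimension of (a + b) ∩ c complementary to that of (a ∩ b) + c, so the triple
  -- intersection cancels in the quotient.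
  have h4 : σ.orthogonal (a.carrier ⊓ b.carrier ⊔ c.carrier) = formSpace a c b := by
    ext x
    rw [formSpace, ← orthogonal_inf hσ]
    constructor
    · intro hx
      exact ⟨fun y hy => hx y (Submodule.mem_sup_left hy),
        mem_of_forall hσ fun y hy => hx y (Submodule.mem_sup_right hy)⟩
    · intro hx y hy
      obtain ⟨u, hu, v, hv, rfl⟩ := Submodule.mem_sup.1 hy
      change σ (u + v) x = 0
      have h : σ u x = 0 := hx.1 u hu
      rw [map_add, LinearMap.add_apply, h, c.isotropic v hv x hx.2, add_zero]
  have h5 := LinearMap.BilinForm.finrank_orthogonal hσ.nondegenerate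
    (a.carrier ⊓ b.carrier ⊔ c.carrier)
  rw [h4] at h5
  have h6 := (a.carrier ⊓ b.carrier ⊔ c.carrier).finrank_le
  have h7 := c.two_mul_finrank
  lia

/-- With p, n, r the positive index, negative index and nullity, p + r/2 = ½((p − n) + (p + n + r)),
and p + n + r = ½ dim V − dim(a ∩ b). -/
theorem posMaslovIndex_eq (hσ : IsSymplectic σ) (a b c : LagrangianPlane σ) :
    posMaslovIndex c a b = (tripleIndex a b c : ℝ) / 2 + (finrank ℝ V : ℝ) / 4 -
      (finrank ℝ ↥(a.carrier ⊓ b.carrier) : ℝ) / 2 := by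
  have h1 := sigPos_add_sigNeg_add_radical (Q := form a c b)
  have h2 := finrank_form_space hσ a b c
  have h3 := signature_form a b c
  rw [← h1] at h2
  rify at h2
  rw [posMaslovIndex, ← h3, signature]
  push_cast
  linarith

/-- The change of reference plane is a coboundary: a function of b minus the same function of a. -/
theorem posMaslovIndex_sub (hσ : IsSymplectic σ) (a b c d : LagrangianPlane σ) :
    posMaslovIndex c a b - posMaslovIndex d a b =
      (tripleIndex b c d : ℝ) / 2 - (tripleIndex a c d : ℝ) / 2 := by
  have h := tripleIndex_cocycle hσ a b c d
  rify at h
  rw [posMaslovIndex_eq hσ, posMaslovIndex_eq hσ]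
  linarith

/-- The index of a partition of a closed curve does not depend on the reference plane. -/
theorem partitionIndex_eq_of_closed (hσ : IsSymplectic σ) {T : ℝ}
    (Λ : Set.Icc (0 : ℝ) T → LagrangianPlane σ) (D : IntervalPartition T)
    (h : Λ (D.t 0) = Λ (D.t (Fin.last D.N))) (Γ Δ : LagrangianPlane σ) :
    partitionIndex Γ Λ D = partitionIndex Δ Λ D := by
  rw [← sub_eq_zero, partitionIndex, partitionIndex, ← Finset.sum_sub_distrib]
  simp only [posMaslovIndex_sub hσ, Finset.sum_sub_distrib]
  let g : Fin (D.N + 1) → ℝ := fun i => (tripleIndex (Λ (D.t i)) Γ Δ : ℝ) / 2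
  have h1 := Fin.sum_univ_succ g
  have h2 := Fin.sum_univ_castSucc g
  have h3 : g 0 = g (Fin.last D.N) := by simp only [g, h]
  change ∑ i : Fin D.N, g i.succ - ∑ i : Fin D.N, g i.castSucc = 0
  linarith

end Symp

theorem mainTheorem9 {V : Type*} [AddCommGroup V] [Module ℝ V] [FiniteDimensional ℝ V]
    (σ : LinearMap.BilinForm ℝ V) (hσ : Symp.IsSymplectic σ)
    (T : ℝ) (hT : 0 < T) (Λ : Set.Icc (0 : ℝ) T → Symp.LagrangianPlane σ)
    (hclosed : Λ ⟨0, Set.left_mem_Icc.2 hT.le⟩ = Λ ⟨T, Set.right_mem_Icc.2 hT.le⟩)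
    (hmono : Symp.IsMonotoneIncreasing Λ) (Γ Δ : Symp.LagrangianPlane σ) :
    Symp.curveIndex Γ Λ = Symp.curveIndex Δ Λ := by
  refine iSup_congr fun D => ?_
  have h0 : D.t 0 = ⟨0, Set.left_mem_Icc.2 hT.le⟩ := Subtype.ext D.first
  have h1 : D.t (Fin.last D.N) = ⟨T, Set.right_mem_Icc.2 hT.le⟩ := Subtype.ext D.last
  rw [Symp.partitionIndex_eq_of_closed hσ Λ D (by rw [h0, h1, hclosed]) Γ Δ]
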